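/- Let $M$ be a smooth manifold of dimension $m$ (Hausdorff, second countable, without boundary, not necessarily compact). If $q \ge m(m+1)/2$, then there exist smooth maps $f_i : M \to \mathbb{R}^2$, $i = 1, \dots, q$, such that the 2-forms $f_i^*(dx\wedge dy)$ span the exterior bundle $\Lambda^2(T^*M)$; that is, for every $x \in M$ the forms $(f_1^*(dx\wedge dy))_x, \dots, (f_q^*(dx\wedge dy))_x$ span the vector space $\Lambda^2(T_x^*M)$ of alternating bilinear forms on $T_xM$. -/

import Mathlib

open scoped Manifold ContDiff

noncomputable section

/-- The fibre at `x` of the bundle `Λ^k(T^*M)`: alternating `k`-linear forms on the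
tangent space of `M` at `x`. -/
abbrev FormFibre {E H M : Type*} [NormedAddCommGroup E] [NormedSpace ℝ E] [TopologicalSpace H]
    (I : ModelWithCorners ℝ E H) [TopologicalSpace M] [ChartedSpace H M] (k : ℕ) (x : M) :=
  TangentSpace I x [⋀^Fin k]→L[ℝ] ℝ

/-- The pullback `f^*η` of a `k`-form `η` along a map `f` between manifolds:
`(f^*η)_x (v₁, …, v_k) = η_{f x} (df_x v₁, …, df_x v_k)`. -/
def pullbackForm {E H M E' H' N : Type*}
    [NormedAddCommGroup E] [NormedSpace ℝ E] [TopologicalSpace H] (I : ModelWithCorners ℝ E H)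
    [TopologicalSpace M] [ChartedSpace H M]
    [NormedAddCommGroup E'] [NormedSpace ℝ E'] [TopologicalSpace H'] (I' : ModelWithCorners ℝ E' H')
    [TopologicalSpace N] [ChartedSpace H' N]
    {k : ℕ} (f : M → N) (η : (y : N) → FormFibre I' k y) (x : M) : FormFibre I k x :=
  (η (f x)).compContinuousLinearMap (mfderiv I I' f x)

/-- The alternating form `(v, w) ↦ v₀ w₁ - v₁ w₀` on `ℝ²`. -/
def areaForm₂ : EuclideanSpace ℝ (Fin 2) [⋀^Fin 2]→L[ℝ] ℝ where
  toFun v := v 0 0 * v 1 1 - v 0 1 * v 1 0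
  map_update_add' v i a b := by
    fin_cases i <;> simp [Function.update] <;> ring
  map_update_smul' v i c a := by
    fin_cases i <;> simp [Function.update] <;> ring
  map_eq_zero_of_eq' v i j h hij := by
    have h01 : v 0 = v 1 := by
      fin_cases i <;> fin_cases j <;> simp_all
    simp only [h01]
    ring
  cont := by fun_prop

theorem areaForm₂_apply (v : Fin 2 → EuclideanSpace ℝ (Fin 2)) :
    areaForm₂ v = v 0 0 * v 1 1 - v 0 1 * v 1 0 := rfl

/-- The 2-form `dx ∧ dy` on the manifold `ℝ²`, a constant form. -/
def dxdy (y : EuclideanSpace ℝ (Fin 2)) : FormFibre (𝓡 2) 2 y := areaForm₂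

end

open Set Filter Topology

/-! This is a transversality argument. The forms `α i ∧ β i` fail to span exactly when a nonzero
bivector `Ω` satisfies `Ω(α i, β i) = 0` for all `i`. Each equation cuts out a hypersurface, and `Ω`
up to scale has `m(m-1)/2 - 1` parameters, so degenerate tuples have codimension at least `q -
m(m-1)/2 + 1 ≥ m + 1`. A generic translate of an `m`-parameter family of tuples therefore misses
them. In place of Sard's theorem, the bad translations are covered by finitely many `C¹` images of
sets in spaces of too small dimension (`dense_setOf_forall_not_isDegenerate`).

On `M`, the components of the maps are taken to be combinations `∑ A s * u s` of a countable,
locally finite family containing chart coordinates near every point. Good coefficients near a given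
point contain an open dense set, since varying the coefficients of the coordinates translates the
derivatives freely. Baire's theorem in the countable product of lines gives one `A` good everywhere.
-/

/-- Extension by zero of a function defined on a subtype. -/
noncomputable def extendZero {α : Type*} (P : α → Prop) [DecidablePred P] (f : {x // P x} → ℝ) (x : α) : ℝ :=
  if h : P x then f ⟨x, h⟩ else 0

theorem contDiff_extendZero {α : Type*} [Fintype α] (P : α → Prop) [DecidablePred P] (x : α)
    {n : WithTop ℕ∞} : ContDiff ℝ n fun f : {x // P x} → ℝ => extendZero P f x := by
  unfold extendZero
  split_ifs
  · fun_prop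
  · fun_prop

theorem extendZero_restrict {α : Type*} (P : α → Prop) [DecidablePred P] (f : α → ℝ) (x : α) :
    extendZero P (fun y => f y.1) x = if P x then f x else 0 := by
  simp [extendZero]

/-! ### Degenerate tuples of covector pairs -/

/-- A family `L` of `q` pairs of covectors on `ℝᵐ` is degenerate if the forms
`L (i, 0, ·) ∧ L (i, 1, ·)` are all annihilated by a nonzero bivector. -/
def IsDegenerate {q m : ℕ} (L : Fin q × Fin 2 × Fin m → ℝ) : Prop :=
  ∃ Ω : Fin m × Fin m → ℝ, Ω ≠ 0 ∧ (∀ p, Ω p.swap = -Ω p) ∧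
    ∀ i, ∑ j, (∑ l, Ω (l, j) * L (i, 0, l)) * L (i, 1, j) = 0

theorem isClosed_setOf_exists_of_compact {X Y : Type*} [TopologicalSpace X] [TopologicalSpace Y]
    {K : Set Y} (hK : IsCompact K) {R : Y → X → Prop} (hR : IsClosed {p : K × X | R p.1 p.2}) :
    IsClosed {x | ∃ y ∈ K, R y x} := by
  have : CompactSpace K := isCompact_iff_compactSpace.1 hK
  convert isClosedMap_snd_of_compactSpace _ hR using 1
  ext x
  simp

/-- The condition is homogeneous in `Ω`, so `Ω` may be taken on the unit sphere, and projection
along a compact factor is closed. -/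
theorem isClosed_setOf_isDegenerate (q m : ℕ) :
    IsClosed {L : Fin q × Fin 2 × Fin m → ℝ | IsDegenerate L} := by
  have key := isClosed_setOf_exists_of_compact
    (isCompact_sphere (0 : Fin m × Fin m → ℝ) 1)
    (R := fun (Ω : Fin m × Fin m → ℝ) (L : Fin q × Fin 2 × Fin m → ℝ) =>
      (∀ p, Ω p.swap = -Ω p) ∧
      ∀ i, ∑ j, (∑ l, Ω (l, j) * L (i, 0, l)) * L (i, 1, j) = 0) ?_
  · convert key using 1
    ext L
    constructor
    · rintro ⟨Ω, h0, ha, hL⟩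
      refine ⟨‖Ω‖⁻¹ • Ω, ?_, fun p => by simp [ha], fun i => ?_⟩
      · simp [norm_smul, h0]
      · have := congrArg (‖Ω‖⁻¹ * ·) (hL i)
        simpa [Finset.mul_sum, Finset.sum_mul, mul_assoc] using this
    · rintro ⟨Ω, h0, ha, hL⟩
      exact ⟨Ω, by rintro rfl; simp at h0, ha, hL⟩
  · have hc : ∀ p, Continuous fun x : Metric.sphere (0 : Fin m × Fin m → ℝ) 1 ×
        (Fin q × Fin 2 × Fin m → ℝ) => (x.1 : Fin m × Fin m → ℝ) p := fun p =>
      (continuous_apply p).comp (continuous_subtype_val.comp continuous_fst)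
    have hd : ∀ t, Continuous fun x : Metric.sphere (0 : Fin m × Fin m → ℝ) 1 ×
        (Fin q × Fin 2 × Fin m → ℝ) => x.2 t := fun t => (continuous_apply t).comp continuous_snd
    refine IsClosed.and ?_ ?_
    · rw [Set.ofPred_forall]
      exact isClosed_iInter fun p => isClosed_eq (hc _) (hc _).neg
    · rw [Set.ofPred_forall]
      exact isClosed_iInter fun i => isClosed_eq (continuous_finsetSum _ fun j _ =>
        (continuous_finsetSum _ fun l _ => (hc _).mul (hd _)).mul (hd _)) continuous_const

/-! ### Parametrizing degenerate tuples -/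

/-- The bivector with coordinate `1` at `(a, b)` and prescribed other coordinates. -/
noncomputable def normalizedBivector {m : ℕ} (a b : Fin m)
    (c : {p : Fin m × Fin m // p.1 < p.2 ∧ p ≠ (a, b)} → ℝ) (p : Fin m × Fin m) : ℝ :=
  ((if p = (a, b) then 1 else 0) + extendZero _ c p) -
    ((if p.swap = (a, b) then 1 else 0) + extendZero _ c p.swap)

theorem contDiff_normalizedBivector {m : ℕ} (a b : Fin m) (p : Fin m × Fin m) {n : WithTop ℕ∞} :
    ContDiff ℝ n fun c => normalizedBivector a b c p := by
  unfold normalizedBivector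
  exact (contDiff_const.add (contDiff_extendZero _ _)).sub
    (contDiff_const.add (contDiff_extendZero _ _))

theorem normalizedBivector_restrict {m : ℕ} {a b : Fin m} (hab : a < b) {Ω : Fin m × Fin m → ℝ}
    (hΩ : ∀ p, Ω p.swap = -Ω p) (h1 : Ω (a, b) = 1) :
    normalizedBivector a b (fun p => Ω p.1) = Ω := by
  ext ⟨j, k⟩
  have hjk := hΩ (j, k)
  unfold normalizedBivector
  simp only [extendZero_restrict, Prod.swap_prod_mk, Prod.mk.injEq, ne_eq, not_and] at *
  rcases lt_trichotomy j k with h | h | h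
  · by_cases h' : j = a ∧ k = b
    · obtain ⟨rfl, rfl⟩ := h'
      simp [h1, h.ne, h.ne', h.not_gt]
    · have h2 : ¬(k = a ∧ j = b) := by rintro ⟨rfl, rfl⟩; exact absurd hab h.not_gt
      have h3 : j = a → ¬ k = b := by tauto
      simp [h, h', h2, h.not_gt]
  · subst h
    have h2 : ¬(j = a ∧ j = b) := by rintro ⟨rfl, rfl⟩; exact lt_irrefl _ hab
    have : Ω (j, j) = 0 := by linarith
    simp [this]
  · by_cases h' : k = a ∧ j = b
    · obtain ⟨rfl, rfl⟩ := h'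
      simp [h.ne, h.ne', h.not_gt]
      linarith
    · have h2 : ¬(j = a ∧ k = b) := by rintro ⟨rfl, rfl⟩; exact absurd hab h.not_gt
      have h3 : k = a → ¬ j = b := by tauto
      simp only [h.not_gt, h, h', h2, false_and, true_and, if_false, if_pos h3]
      linarith

/-- The coefficients of a linear equation satisfied by the row `X (i, k, ·)` when the bivector `Ω`
annihilates `X (i, 0, ·) ∧ X (i, 1, ·)` (for `k = 1`), or when `X (i, 0, ·)` lies in the kernel
of `Ω` (for `k = 0`). -/
noncomputable def rowWeight {q m : ℕ} (b : Fin m) (Ω : Fin m × Fin m → ℝ) (X : Fin q × Fin 2 × Fin m → ℝ)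
    (i : Fin q) (k : Fin 2) (j : Fin m) : ℝ :=
  if k = 1 then ∑ l, Ω (l, j) * X (i, 0, l) else Ω (j, b)

/-- For every `i`, fill the entry `s i` of `X (i, ·, ·)` with the solution of the linear equation
given by `rowWeight`. -/
noncomputable def fillEntry {q m : ℕ} (b : Fin m) (s : Fin q → Fin 2 × Fin m) (Ω : Fin m × Fin m → ℝ)
    (X : Fin q × Fin 2 × Fin m → ℝ) (t : Fin q × Fin 2 × Fin m) : ℝ :=
  if t.2 = s t.1 then
    -(∑ j, rowWeight b Ω X t.1 t.2.1 j * X (t.1, t.2.1, j)) / rowWeight b Ω X t.1 t.2.1 t.2.2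
  else X t

theorem rowWeight_congr {q m : ℕ} (b : Fin m) (Ω : Fin m × Fin m → ℝ)
    {X Y : Fin q × Fin 2 × Fin m → ℝ} {i : Fin q} {k : Fin 2}
    (h : k = 1 → ∀ l, X (i, 0, l) = Y (i, 0, l)) (j : Fin m) :
    rowWeight b Ω X i k j = rowWeight b Ω Y i k j := by
  unfold rowWeight
  split_ifs with hk
  · simp [h hk]
  · rfl

/-- The weights for row `1` involve only row `0`, and those for row `0` only `Ω`, so erasing the
entry `s i` does not change the weights of its own row. The erased entry being `0`, the full sum in
`fillEntry` consists of the known terms only. -/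
theorem fillEntry_erase {q m : ℕ} {b : Fin m} {s : Fin q → Fin 2 × Fin m}
    {Ω : Fin m × Fin m → ℝ} {X : Fin q × Fin 2 × Fin m → ℝ}
    (h0 : ∀ i, rowWeight b Ω X i (s i).1 (s i).2 ≠ 0)
    (hX : ∀ i, ∑ j, rowWeight b Ω X i (s i).1 j * X (i, (s i).1, j) = 0) :
    (∀ i, rowWeight b Ω (fun t => if t.2 ≠ s t.1 then X t else 0) i (s i).1 (s i).2 ≠ 0) ∧
    fillEntry b s Ω (fun t => if t.2 ≠ s t.1 then X t else 0) = X := by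
  have hw : ∀ i j, rowWeight b Ω (fun t => if t.2 ≠ s t.1 then X t else 0) i (s i).1 j =
      rowWeight b Ω X i (s i).1 j := fun i j => by
    refine rowWeight_congr b Ω (fun hk l => if_pos ?_) j
    intro h
    rw [← h] at hk
    simp at hk
  refine ⟨fun i => by rw [hw]; exact h0 i, ?_⟩
  ext ⟨i, k, j⟩
  unfold fillEntry
  split_ifs with ht
  · have hk : k = (s i).1 := congrArg Prod.fst ht
    have hj : j = (s i).2 := congrArg Prod.snd ht
    subst hk hj
    simp only [hw]
    have hsum := hX i
    rw [← Finset.add_sum_erase _ _ (Finset.mem_univ (s i).2)] at hsum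
    rw [div_eq_iff (h0 i), neg_eq_iff_add_eq_zero,
      ← Finset.add_sum_erase _ _ (Finset.mem_univ (s i).2)]
    have : ∀ l ∈ Finset.univ.erase (s i).2,
        rowWeight b Ω X i (s i).1 l * (if ((s i).1, l) ≠ s i then X (i, (s i).1, l) else 0) =
        rowWeight b Ω X i (s i).1 l * X (i, (s i).1, l) := by
      intro l hl
      rw [if_pos]
      intro h
      exact Finset.ne_of_mem_erase hl (congrArg Prod.snd h)
    rw [Finset.sum_congr rfl this]
    simp only [Prod.mk.eta, ne_eq, not_true_eq_false, if_false]
    linarith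
  · exact if_pos ht

theorem IsDegenerate.exists_normalized {q m : ℕ} {X : Fin q × Fin 2 × Fin m → ℝ}
    (h : IsDegenerate X) : ∃ a b : Fin m, a < b ∧ ∃ Ω : Fin m × Fin m → ℝ, Ω (a, b) = 1 ∧
      (∀ p, Ω p.swap = -Ω p) ∧ ∃ s : Fin q → Fin 2 × Fin m,
      (∀ i, rowWeight b Ω X i (s i).1 (s i).2 ≠ 0) ∧
      ∀ i, ∑ j, rowWeight b Ω X i (s i).1 j * X (i, (s i).1, j) = 0 := by
  obtain ⟨Ω, h0, ha, hL⟩ := h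
  obtain ⟨a, b, hab, hne⟩ : ∃ a b, a < b ∧ Ω (a, b) ≠ 0 := by
    by_contra! hc
    refine h0 (funext fun ⟨j, k⟩ => ?_)
    have hjk := ha (j, k)
    rcases lt_trichotomy j k with h | rfl | h
    · exact hc _ _ h
    · simp at hjk ⊢; linarith
    · have := hc _ _ h
      simp at hjk ⊢; linarith
  refine ⟨a, b, hab, (Ω (a, b))⁻¹ • Ω, by simp [hne], fun p => by simp [ha], ?_⟩
  have hL' : ∀ i, ∑ j, (∑ l, ((Ω (a, b))⁻¹ • Ω) (l, j) * X (i, 0, l)) * X (i, 1, j) = 0 := by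
    intro i
    have := congrArg ((Ω (a, b))⁻¹ * ·) (hL i)
    simpa [Finset.mul_sum, Finset.sum_mul, mul_assoc] using this
  have h1 : ((Ω (a, b))⁻¹ • Ω) (a, b) = 1 := by simp [hne]
  generalize (Ω (a, b))⁻¹ • Ω = Ω' at hL' h1
  have hs : ∀ i, ∃ s : Fin 2 × Fin m, rowWeight b Ω' X i s.1 s.2 ≠ 0 ∧
      ∑ j, rowWeight b Ω' X i s.1 j * X (i, s.1, j) = 0 := by
    intro i
    -- If the contraction of row `0` with `Ω'` is nonzero, the equation can be solved for an entry
    -- of row `1`. Otherwise row `0` lies in the kernel; component `b` of this condition is an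
    -- equation for entry `a`, with coefficient `Ω' (a, b) = 1`.
    by_cases hi : ∃ j, ∑ l, Ω' (l, j) * X (i, 0, l) ≠ 0
    · obtain ⟨j, hj⟩ := hi
      exact ⟨(1, j), by simpa [rowWeight] using hj, by simpa [rowWeight] using hL' i⟩
    · push Not at hi
      exact ⟨(0, a), by simp [rowWeight, h1], by simpa [rowWeight] using hi b⟩
  choose s hs using hs
  exact ⟨s, fun i => (hs i).1, fun i => (hs i).2⟩

/-! ### Dimension count and generic translation -/

theorem two_mul_card_lt_ne {m : ℕ} {a b : Fin m} (hab : a < b) :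
    2 * Fintype.card {p : Fin m × Fin m // p.1 < p.2 ∧ p ≠ (a, b)} + 2 + m = m * m := by
  have h1 : Fintype.card {p : Fin m × Fin m // p.1 < p.2 ∧ p ≠ (a, b)} + 1 =
      (Finset.univ.filter fun p : Fin m × Fin m => p.1 < p.2).card := by
    rw [Fintype.card_subtype, ← Finset.card_erase_add_one (a := (a, b))
      (s := Finset.univ.filter fun p : Fin m × Fin m => p.1 < p.2) (by simpa using hab)]
    congr 2
    ext p
    simp [and_comm]
  have h2 : (Finset.univ.filter fun p : Fin m × Fin m => p.2 < p.1).card =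
      (Finset.univ.filter fun p : Fin m × Fin m => p.1 < p.2).card :=
    Finset.card_equiv (Equiv.prodComm _ _) (by simp)
  have h3 : (Finset.univ.filter fun p : Fin m × Fin m => p.1 = p.2).card = m := by
    have := Finset.diag_card (Finset.univ : Finset (Fin m))
    rw [Finset.card_fin] at this
    refine Eq.trans (congrArg Finset.card ?_) this
    ext ⟨p, r⟩
    simp
  have h4 : (Finset.univ.filter fun p : Fin m × Fin m => p.1 < p.2).card +
      ((Finset.univ.filter fun p : Fin m × Fin m => p.2 < p.1).card +
      (Finset.univ.filter fun p : Fin m × Fin m => p.1 = p.2).card) = m * m := by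
    rw [← Finset.card_union_of_disjoint, ← Finset.card_union_of_disjoint]
    · trans (Finset.univ : Finset (Fin m × Fin m)).card
      · congr 1
        ext p
        rcases lt_trichotomy p.1 p.2 with h | h | h <;> simp [h]
      · simp
    · simp only [Finset.disjoint_left, Finset.mem_union, Finset.mem_filter, Finset.mem_univ,
        true_and]
      rintro p h (h' | h')
      · exact h.not_gt h'
      · exact h.ne h'
    · simp only [Finset.disjoint_left, Finset.mem_filter, Finset.mem_univ, true_and]
      exact fun p h => h.ne'
  omega

theorem card_ne_entry_add {q m : ℕ} (s : Fin q → Fin 2 × Fin m) :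
    Fintype.card {t : Fin q × Fin 2 × Fin m // t.2 ≠ s t.1} + q = q * (2 * m) := by
  have h1 : Fintype.card {t : Fin q × Fin 2 × Fin m // t.2 = s t.1} = q := by
    rw [Fintype.card_congr (β := Fin q)
      { toFun := fun t => t.1.1
        invFun := fun i => ⟨(i, s i), rfl⟩
        left_inv := fun ⟨⟨i, t⟩, h⟩ => by simp at h; simp [h]
        right_inv := fun i => rfl }, Fintype.card_fin]
  have h2 := Fintype.card_subtype_compl (fun t : Fin q × Fin 2 × Fin m => t.2 = s t.1)
  have h3 := Fintype.card_subtype_le (fun t : Fin q × Fin 2 × Fin m => t.2 = s t.1)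
  simp only [Fintype.card_prod, Fintype.card_fin] at h2 h3
  rw [h1] at h2 h3
  simp only [ne_eq]
  omega

/-- A `C¹` image of a set has dimension at most that of the source space. -/
theorem dimH_image_le_finrank_of_contDiffAt {E F : Type*} [NormedAddCommGroup E] [NormedSpace ℝ E]
    [FiniteDimensional ℝ E] [NormedAddCommGroup F] [NormedSpace ℝ F] {f : E → F} {s : Set E}
    (hf : ∀ x ∈ s, ContDiffAt ℝ 1 f x) : dimH (f '' s) ≤ Module.finrank ℝ E := by
  calc dimH (f '' s) ≤ dimH s := by
        refine dimH_image_le_of_locally_lipschitzOn fun x hx => ?_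
        obtain ⟨K, t, ht, h⟩ := (hf x hx).exists_lipschitzOnWith
        exact ⟨K, t, mem_nhdsWithin_of_mem_nhds ht, h⟩
    _ ≤ dimH (univ : Set E) := dimH_mono (subset_univ _)
    _ = Module.finrank ℝ E := Real.dimH_univ_eq_finrank E

theorem contDiffAt_rowWeight {q m : ℕ} (b : Fin m) {E : Type*} [NormedAddCommGroup E]
    [NormedSpace ℝ E] {Ω : E → Fin m × Fin m → ℝ} {X : E → Fin q × Fin 2 × Fin m → ℝ} {x : E}
    (hΩ : ∀ p, ContDiffAt ℝ 1 (fun y => Ω y p) x) (hX : ∀ t, ContDiffAt ℝ 1 (fun y => X y t) x)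
    (i : Fin q) (k : Fin 2) (j : Fin m) :
    ContDiffAt ℝ 1 (fun y => rowWeight b (Ω y) (X y) i k j) x := by
  unfold rowWeight
  split_ifs
  · exact ContDiffAt.sum fun l _ => (hΩ _).mul (hX _)
  · exact hΩ _

theorem contDiffAt_fillEntry {q m : ℕ} (b : Fin m) (s : Fin q → Fin 2 × Fin m) {E : Type*}
    [NormedAddCommGroup E] [NormedSpace ℝ E] {Ω : E → Fin m × Fin m → ℝ}
    {X : E → Fin q × Fin 2 × Fin m → ℝ} {x : E}
    (hΩ : ∀ p, ContDiffAt ℝ 1 (fun y => Ω y p) x) (hX : ∀ t, ContDiffAt ℝ 1 (fun y => X y t) x)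
    (h0 : ∀ i, rowWeight b (Ω x) (X x) i (s i).1 (s i).2 ≠ 0) (t : Fin q × Fin 2 × Fin m) :
    ContDiffAt ℝ 1 (fun y => fillEntry b s (Ω y) (X y) t) x := by
  unfold fillEntry
  split_ifs with ht
  · have hw := contDiffAt_rowWeight b hΩ hX t.1 t.2.1
    refine ContDiffAt.div (ContDiffAt.sum fun j _ => (hw j).mul (hX _)).neg (hw _) ?_
    rw [ht]
    exact h0 t.1
  · exact hX t

/-- If `2 q ≥ m (m + 1)`, a generic constant perturbation of a `C¹` family, parametrized by an
`m`-dimensional space, of `q`-tuples of pairs of covectors on `ℝᵐ` is nowhere degenerate. -/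
theorem dense_setOf_forall_not_isDegenerate {q m : ℕ} (hq : m * (m + 1) ≤ 2 * q) {E : Type*}
    [NormedAddCommGroup E] [NormedSpace ℝ E] [FiniteDimensional ℝ E]
    (hE : Module.finrank ℝ E = m) {V : Set E} {D : E → Fin q × Fin 2 × Fin m → ℝ}
    (hD : ∀ y ∈ V, ContDiffAt ℝ 1 D y) :
    Dense {T | ∀ y ∈ V, ¬ IsDegenerate (T + D y)} := by
  -- `Ψ` sends a point, the free coordinates of a bivector and the free entries of a tuple to the
  -- translation `T` for which `T + D y` is the filled tuple.
  let Ψ (a b : Fin m) (s : Fin q → Fin 2 × Fin m) (z : E ×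
    ({p : Fin m × Fin m // p.1 < p.2 ∧ p ≠ (a, b)} → ℝ) ×
      ({t : Fin q × Fin 2 × Fin m // t.2 ≠ s t.1} → ℝ)) : Fin q × Fin 2 × Fin m → ℝ := fun t =>
    fillEntry b s (normalizedBivector a b z.2.1)
      (extendZero (fun t : Fin q × Fin 2 × Fin m => t.2 ≠ s t.1) z.2.2) t - D z.1 t
  let U (a b : Fin m) (s : Fin q → Fin 2 × Fin m) : Set (E ×
    ({p : Fin m × Fin m // p.1 < p.2 ∧ p ≠ (a, b)} → ℝ) ×
      ({t : Fin q × Fin 2 × Fin m // t.2 ≠ s t.1} → ℝ)) :=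
    {z | z.1 ∈ V ∧ ∀ i, rowWeight b (normalizedBivector a b z.2.1)
      (extendZero (fun t : Fin q × Fin 2 × Fin m => t.2 ≠ s t.1) z.2.2) i (s i).1 (s i).2 ≠ 0}
  have hcover : {T | ∀ y ∈ V, ¬ IsDegenerate (T + D y)}ᶜ ⊆
      ⋃ c : {c : Fin m × Fin m // c.1 < c.2} × (Fin q → Fin 2 × Fin m),
        Ψ c.1.1.1 c.1.1.2 c.2 '' U c.1.1.1 c.1.1.2 c.2 := by
    intro T hT
    simp only [mem_compl_iff, mem_ofPred_eq, not_forall, not_not] at hT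
    obtain ⟨y, hy, hdeg⟩ := hT
    obtain ⟨a, b, hab, Ω, h1, ha, s, h0, hX⟩ := hdeg.exists_normalized
    obtain ⟨hw, hfill⟩ := fillEntry_erase h0 hX
    have hext : extendZero (fun t : Fin q × Fin 2 × Fin m => t.2 ≠ s t.1)
        (fun t => (T + D y) t.1) = fun t => if t.2 ≠ s t.1 then (T + D y) t else 0 :=
      funext fun t => extendZero_restrict _ _ t
    refine mem_iUnion.2 ⟨⟨⟨(a, b), hab⟩, s⟩, (y, fun p => Ω p.1, fun t => (T + D y) t.1), ?_, ?_⟩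
    · refine ⟨hy, ?_⟩
      simp only [normalizedBivector_restrict hab ha h1, hext]
      exact hw
    · ext t
      simp only [Ψ, normalizedBivector_restrict hab ha h1, hext, hfill]
      simp
  have hdim : ∀ a b : Fin m, a < b → ∀ s : Fin q → Fin 2 × Fin m,
      dimH (Ψ a b s '' U a b s) ≤ (q * (2 * m) - 1 : ℕ) := by
    intro a b hab s
    refine (dimH_image_le_finrank_of_contDiffAt fun z hz => ?_).trans ?_
    · refine contDiffAt_pi.2 fun t => ContDiffAt.sub ?_ ?_
      · refine contDiffAt_fillEntry b s (fun p => ?_) (fun p => ?_) hz.2 t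
        · exact ((contDiff_normalizedBivector a b p).comp
            (contDiff_fst.comp contDiff_snd)).contDiffAt
        · exact ((contDiff_extendZero _ p).comp (contDiff_snd.comp contDiff_snd)).contDiffAt
      · exact (contDiffAt_pi.1 (hD z.1 hz.1) t).comp z contDiffAt_fst
    · have h1 := two_mul_card_lt_ne hab
      have h2 := card_ne_entry_add s
      simp only [Module.finrank_prod, Module.finrank_fintype_fun_eq_card, hE]
      norm_cast
      have : m * (m + 1) = m * m + m := by ring
      omega
  -- The empty case is separate because the ambient dimension may be `0`; a bad `T` provides an `a :
  -- Fin m`, whence `m` and `q` are positive.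
  have hlt : dimH {T | ∀ y ∈ V, ¬ IsDegenerate (T + D y)}ᶜ <
      Module.finrank ℝ (Fin q × Fin 2 × Fin m → ℝ) ∨
      {T | ∀ y ∈ V, ¬ IsDegenerate (T + D y)}ᶜ = ∅ := by
    rcases eq_empty_or_nonempty {T | ∀ y ∈ V, ¬ IsDegenerate (T + D y)}ᶜ with h | ⟨T, hT⟩
    · exact Or.inr h
    left
    obtain ⟨⟨⟨⟨a, b⟩, hab⟩, s⟩, -⟩ := mem_iUnion.1 (hcover hT)
    refine ((dimH_mono hcover).trans ((dimH_iUnion _).trans_le (iSup_le fun c => hdim _ _ c.1.2 c.2))).trans_lt ?_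
    simp only [Module.finrank_fintype_fun_eq_card, Fintype.card_prod, Fintype.card_fin]
    have hm : 0 < m := a.pos
    have hq0 : 0 < q := by nlinarith
    have : 0 < q * (2 * m) := by positivity
    norm_cast
    omega
  rw [← compl_compl {T | ∀ y ∈ V, ¬ IsDegenerate (T + D y)}]
  rcases hlt with h | h
  · exact dense_compl_of_dimH_lt_finrank h
  · rw [h, compl_empty]
    exact dense_univ

/-! ### Nondegeneracy and spanning -/

section Algebra

variable {F : Type*} [AddCommGroup F] [Module ℝ F] [TopologicalSpace F] {m : ℕ}

/-- The wedge product of the `j`-th and `k`-th covectors of the dual basis given by a linear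
equivalence with `ℝᵐ`. -/
noncomputable def coordWedge (e : F ≃L[ℝ] EuclideanSpace ℝ (Fin m)) (j k : Fin m) :
    F [⋀^Fin 2]→L[ℝ] ℝ :=
  areaForm₂.compContinuousLinearMap
    (((EuclideanSpace.equiv (Fin 2) ℝ).symm : (Fin 2 → ℝ) →L[ℝ] EuclideanSpace ℝ (Fin 2)).comp
      (ContinuousLinearMap.pi fun i =>
        (EuclideanSpace.proj (![j, k] i) : EuclideanSpace ℝ (Fin m) →L[ℝ] ℝ).comp
          (e : F →L[ℝ] EuclideanSpace ℝ (Fin m))))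

theorem coordWedge_apply (e : F ≃L[ℝ] EuclideanSpace ℝ (Fin m)) (j k : Fin m) (v : Fin 2 → F) :
    coordWedge e j k v = e (v 0) j * e (v 1) k - e (v 0) k * e (v 1) j := rfl

/-- The factor `1/2` appears because the sum runs over ordered pairs. -/
theorem eq_sum_coordWedge (e : F ≃L[ℝ] EuclideanSpace ℝ (Fin m)) (η : F [⋀^Fin 2]→L[ℝ] ℝ) :
    η = ∑ j, ∑ k, (η ![e.symm (EuclideanSpace.single j 1), e.symm (EuclideanSpace.single k 1)] / 2)
      • coordWedge e j k := by
  apply ContinuousAlternatingMap.toAlternatingMap_injective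
  refine Module.Basis.ext_alternating
    ((EuclideanSpace.basisFun (Fin m) ℝ).toBasis.map e.symm.toLinearEquiv) fun v _ => ?_
  have hη : η ![e.symm (EuclideanSpace.single (v 1) 1), e.symm (EuclideanSpace.single (v 0) 1)] =
      -η ![e.symm (EuclideanSpace.single (v 0) 1), e.symm (EuclideanSpace.single (v 1) 1)] := by
    have := η.toAlternatingMap.map_swap
      ![e.symm (EuclideanSpace.single (v 0) 1), e.symm (EuclideanSpace.single (v 1) 1)]
      (show (0 : Fin 2) ≠ 1 by decide)
    rw [ContinuousAlternatingMap.coe_toAlternatingMap] at this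
    rw [← this]
    congr 1
    ext i
    fin_cases i <;> simp
  have hv : (fun i => ((EuclideanSpace.basisFun (Fin m) ℝ).toBasis.map e.symm.toLinearEquiv) (v i))
      = ![e.symm (EuclideanSpace.single (v 0) 1), e.symm (EuclideanSpace.single (v 1) 1)] := by
    ext i
    fin_cases i <;> simp
  rw [hv]
  simp only [ContinuousAlternatingMap.coe_toAlternatingMap, ContinuousAlternatingMap.sum_apply,
    ContinuousAlternatingMap.smul_apply, coordWedge_apply, smul_eq_mul, mul_sub,
    Finset.sum_sub_distrib]
  simp [hη]
  ring

/-- A proper span is killed by a nonzero functional on 2-forms, whose values on the coordinate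
wedges form an annihilating bivector. -/
theorem span_range_eq_top_of_not_isDegenerate {q : ℕ} (e : F ≃L[ℝ] EuclideanSpace ℝ (Fin m))
    {L : Fin q × Fin 2 × Fin m → ℝ} (hL : ¬ IsDegenerate L)
    (f : Fin q → F →L[ℝ] EuclideanSpace ℝ (Fin 2))
    (hf : ∀ i v k, f i v k = ∑ j, L (i, k, j) * e v j) :
    Submodule.span ℝ (range fun i => areaForm₂.compContinuousLinearMap (f i)) = ⊤ := by
  by_contra hne
  obtain ⟨Λ, hΛ, hle⟩ := Submodule.exists_le_ker_of_lt_top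
    (Submodule.span ℝ (range fun i => areaForm₂.compContinuousLinearMap (f i)))
    (lt_top_iff_ne_top.2 hne)
  refine hL ⟨fun p => Λ (coordWedge e p.1 p.2), fun h0 => hΛ ?_, fun p => ?_, fun i => ?_⟩
  · ext η
    rw [eq_sum_coordWedge e η]
    have h0' : ∀ j k, Λ (coordWedge e j k) = 0 := fun j k => congrFun h0 (j, k)
    simp [h0']
  · have hswap : coordWedge e p.2 p.1 = -coordWedge e p.1 p.2 := by
      ext v
      simp only [ContinuousAlternatingMap.neg_apply, coordWedge_apply]
      ring
    simp [hswap]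
  · have hi : Λ (areaForm₂.compContinuousLinearMap (f i)) = 0 :=
      hle (Submodule.subset_span ⟨i, rfl⟩)
    have hsum : areaForm₂.compContinuousLinearMap (f i) =
        ∑ k, ∑ j, (L (i, 0, j) * L (i, 1, k)) • coordWedge e j k := by
      ext v
      have h : ∀ a b : F, (f i a 0) * (f i b 1) =
          ∑ k, ∑ j, L (i, 0, j) * L (i, 1, k) * (e a j * e b k) := fun a b => by
        rw [hf, hf, Finset.sum_mul_sum, Finset.sum_comm]
        exact Finset.sum_congr rfl fun k _ => Finset.sum_congr rfl fun j _ => by ring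
      have h' : areaForm₂.compContinuousLinearMap (f i) v =
          f i (v 0) 0 * f i (v 1) 1 - f i (v 1) 0 * f i (v 0) 1 := by
        rw [mul_comm (f i (v 1) 0)]
        rfl
      rw [h', h, h]
      simp only [ContinuousAlternatingMap.sum_apply, ContinuousAlternatingMap.smul_apply,
        coordWedge_apply, smul_eq_mul, mul_sub, Finset.sum_sub_distrib]
      congr 1
      exact Finset.sum_congr rfl fun k _ => Finset.sum_congr rfl fun j _ => by ring
    rw [hsum] at hi
    rw [← hi]
    simp only [map_sum, map_smul, smul_eq_mul, Finset.sum_mul]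
    exact Finset.sum_congr rfl fun k _ => Finset.sum_congr rfl fun j _ => by ring

end Algebra

/-! ### Generic coefficients in a chart -/

section Perturbation

variable {q m : ℕ} {S : Type*}

/-- The matrix of partial derivatives of the functions `∑ s ∈ J, A (i, k, s) * h s`. -/
noncomputable def combinationJet (J : Finset S) (h : S → EuclideanSpace ℝ (Fin m) → ℝ)
    (A : Fin q × Fin 2 × S → ℝ) (y : EuclideanSpace ℝ (Fin m)) (t : Fin q × Fin 2 × Fin m) : ℝ :=
  ∑ s ∈ J, A (t.1, t.2.1, s) * fderiv ℝ (h s) y (EuclideanSpace.single t.2.2 1)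

variable {J : Finset S} {h : S → EuclideanSpace ℝ (Fin m) → ℝ} {V : Set (EuclideanSpace ℝ (Fin m))}

/-- Openness needs `K` compact, whereas density below holds on all of `V`. -/
theorem isOpen_setOf_forall_combinationJet (hV : IsOpen V)
    (hh : ∀ s ∈ J, ContDiffOn ℝ ∞ (h s) V) {K : Set (EuclideanSpace ℝ (Fin m))}
    (hK : IsCompact K) (hKV : K ⊆ V) :
    IsOpen {A : Fin q × Fin 2 × S → ℝ | ∀ y ∈ K, ¬ IsDegenerate (combinationJet J h A y)} := by
  rw [← isClosed_compl_iff]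
  have := isClosed_setOf_exists_of_compact hK
    (R := fun y (A : Fin q × Fin 2 × S → ℝ) => IsDegenerate (combinationJet J h A y)) ?_
  · convert this using 1
    ext A
    simp
  · refine (isClosed_setOf_isDegenerate q m).preimage
      (f := fun p : K × (Fin q × Fin 2 × S → ℝ) => combinationJet J h p.2 p.1)
      (continuous_pi fun t => continuous_finsetSum _ fun s hs => Continuous.mul ?_ ?_)
    · exact (continuous_apply _).comp continuous_snd
    · have h1 : ContinuousOn (fderiv ℝ (h s)) V :=
        (hh s hs).continuousOn_fderiv_of_isOpen hV (by simp)
      have h2 : Continuous fun y : K => fderiv ℝ (h s) y :=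
        continuousOn_iff_continuous_domRestrict.1 (h1.mono hKV)
      exact (h2.comp continuous_fst).clm_apply continuous_const

theorem dense_setOf_forall_combinationJet (hq : m * (m + 1) ≤ 2 * q) (hV : IsOpen V)
    (hh : ∀ s ∈ J, ContDiffOn ℝ ∞ (h s) V) {σ : Fin m → S} (hσJ : ∀ l, σ l ∈ J)
    (hσ : ∀ l, ∀ y ∈ V, h (σ l) y = y l) :
    Dense {A : Fin q × Fin 2 × S → ℝ | ∀ y ∈ V, ¬ IsDegenerate (combinationJet J h A y)} := by
  classical
  intro A
  have hD : ∀ y ∈ V, ContDiffAt ℝ 1 (combinationJet J h A) y := fun y hy =>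
    contDiffAt_pi.2 fun t => ContDiffAt.sum fun s hs => contDiffAt_const.mul <|
      ((((hh s hs).contDiffAt (hV.mem_nhds hy)).of_le
        (ENat.LEInfty.out : (2 : WithTop ℕ∞) ≤ ∞)).fderiv_right (m := 1)
        (by rw [one_add_one_eq_two])).clm_apply contDiffAt_const
  have hdense := dense_setOf_forall_not_isDegenerate hq (by simp) hD
  -- Adding `T` to the coefficients of the coordinate functions translates the jet by the constant
  -- `T`.
  let τ : (Fin q × Fin 2 × Fin m → ℝ) → Fin q × Fin 2 × S → ℝ := fun T t =>
    A t + ∑ l, if t.2.2 = σ l then T (t.1, t.2.1, l) else 0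
  have hτ : Continuous τ := continuous_pi fun t => continuous_const.add <|
    continuous_finsetSum _ fun l _ => by split_ifs <;> fun_prop
  have hτ0 : τ 0 = A := by ext t; simp [τ]
  have hjet : ∀ T, ∀ y ∈ V, combinationJet J h (τ T) y = T + combinationJet J h A y := by
    intro T y hy
    ext ⟨i, k, j⟩
    have hder : ∀ l, fderiv ℝ (h (σ l)) y (EuclideanSpace.single j 1) = if l = j then 1 else 0 := by
      intro l
      have h1 : h (σ l) =ᶠ[𝓝 y] EuclideanSpace.proj (𝕜 := ℝ) l := by
        filter_upwards [hV.mem_nhds hy] with z hz using hσ l z hz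
      rw [h1.fderiv_eq, ContinuousLinearMap.fderiv]
      simp
    simp only [combinationJet, τ, add_mul, Finset.sum_add_distrib, Pi.add_apply, Finset.sum_mul]
    rw [add_comm, Finset.sum_comm]
    congr 1
    simp [ite_mul, hσJ, hder]
  rw [← hτ0]
  refine closure_mono ?_ (image_closure_subset_closure_image hτ ⟨0, hdense 0, rfl⟩)
  rintro _ ⟨T, hT, rfl⟩ y hy
  rw [hjet T y hy]
  exact hT y hy

end Perturbation

/-! ### Globalization to the manifold -/

section Manifold

variable {m : ℕ} {M : Type*} [TopologicalSpace M] [ChartedSpace (EuclideanSpace ℝ (Fin m)) M]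
  {S : Type*}

theorem mfderiv_apply_eq_sum_partialDeriv [IsManifold (𝓡 m) ∞ M] {c x : M} (hx : x ∈ (extChartAt (𝓡 m) c).source)
    {J : Finset S} {u : S → M → ℝ} {a : Fin 2 × S → ℝ} {g : M → EuclideanSpace ℝ (Fin 2)}
    (hg : ∀ᶠ z in 𝓝 x, ∀ k, g z k = ∑ s ∈ J, a (k, s) * u s z)
    (hu : ∀ s ∈ J, DifferentiableAt ℝ (u s ∘ (extChartAt (𝓡 m) c).symm) (extChartAt (𝓡 m) c x))
    {g' : TangentSpace (𝓡 m) x →L[ℝ] EuclideanSpace ℝ (Fin 2)}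
    (hg' : mfderiv (𝓡 m) (𝓡 2) g x = g')
    {e : TangentSpace (𝓡 m) x →L[ℝ] EuclideanSpace ℝ (Fin m)}
    (he : mfderiv (𝓡 m) 𝓘(ℝ, EuclideanSpace ℝ (Fin m)) (extChartAt (𝓡 m) c) x = e)
    (v : TangentSpace (𝓡 m) x) (k : Fin 2) :
    g' v k =
      ∑ j, (∑ s ∈ J, a (k, s) * fderiv ℝ (u s ∘ (extChartAt (𝓡 m) c).symm)
        (extChartAt (𝓡 m) c x) (EuclideanSpace.single j 1)) * e v j := by
  set φ := extChartAt (𝓡 m) c with hφ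
  let F : EuclideanSpace ℝ (Fin m) → EuclideanSpace ℝ (Fin 2) := fun y =>
    WithLp.toLp 2 fun k => ∑ s ∈ J, a (k, s) * (u s ∘ φ.symm) y
  have hFk : ∀ k, HasFDerivAt (fun y => F y k)
      (∑ s ∈ J, a (k, s) • fderiv ℝ (u s ∘ φ.symm) (φ x)) (φ x) := fun k =>
    HasFDerivAt.fun_sum fun s hs => (hu s hs).hasFDerivAt.const_mul (a (k, s))
  have hF : DifferentiableAt ℝ F (φ x) :=
    (differentiableAt_euclidean).2 fun k => (hFk k).differentiableAt
  have hFk' : ∀ k w, fderiv ℝ F (φ x) w k =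
      ∑ s ∈ J, a (k, s) * fderiv ℝ (u s ∘ φ.symm) (φ x) w := fun k w => by
    have h := ((EuclideanSpace.proj (𝕜 := ℝ) k).hasFDerivAt.comp (φ x) hF.hasFDerivAt).unique
      (hFk k)
    simpa using DFunLike.congr_fun h w
  have hgF : g =ᶠ[𝓝 x] F ∘ φ := by
    filter_upwards [hg, extChartAt_source_mem_nhds' (I := 𝓡 m) hx] with z hz hzs
    ext k
    simp [F, hz k, φ.left_inv hzs]
  have hφd : MDifferentiableAt (𝓡 m) 𝓘(ℝ, EuclideanSpace ℝ (Fin m)) φ x :=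
    mdifferentiableAt_extChartAt (by rwa [← extChartAt_source (𝓡 m)])
  have hmf : g' = (fderiv ℝ F (φ x)).comp e := by
    rw [← hg', ← he]
    exact ((hF.hasFDerivAt.hasMFDerivAt.comp x hφd.hasMFDerivAt).congr_of_eventuallyEq hgF).mfderiv
  have hbasis : e v = ∑ j, e v j • EuclideanSpace.single j (1 : ℝ) := by
    have := (EuclideanSpace.basisFun (Fin m) ℝ).sum_repr (e v)
    simpa using this.symm
  rw [hmf, ContinuousLinearMap.comp_apply]
  rw [hFk']
  simp only [Finset.sum_mul]
  rw [Finset.sum_comm]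
  refine Finset.sum_congr rfl fun s _ => ?_
  conv_lhs => rw [hbasis]
  rw [map_sum, Finset.mul_sum]
  exact Finset.sum_congr rfl fun j _ => by rw [map_smul, smul_eq_mul]; ring

/-- A smooth manifold carries a countable, locally finite family of smooth functions among which,
near any point, are the coordinates of a chart. -/
theorem exists_locallyFinite_coordinates.{w} (M : Type w) [TopologicalSpace M]
    [ChartedSpace (EuclideanSpace ℝ (Fin m)) M] [IsManifold (𝓡 m) ∞ M] [T2Space M]
    [SigmaCompactSpace M] :
    ∃ (ι : Type w) (_ : Countable ι) (c : ι → M) (u : ι × Fin m → M → ℝ),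
      (∀ s, ContMDiff (𝓡 m) 𝓘(ℝ) ∞ (u s)) ∧ (LocallyFinite fun s => Function.support (u s)) ∧
      ∀ x, ∃ i, ∀ᶠ z in 𝓝 x, z ∈ (extChartAt (𝓡 m) (c i)).source ∧
        ∀ l, u (i, l) z = extChartAt (𝓡 m) (c i) z l := by
  obtain ⟨ι, fs, -⟩ := SmoothBumpCovering.exists_isSubordinate (𝓡 m)
    (isClosed_univ : IsClosed (univ : Set M)) (U := fun _ => univ) fun _ _ => univ_mem
  refine ⟨ι, ?_, fs.c, fun s x => fs s.1 x * extChartAt (𝓡 m) (fs.c s.1) x s.2, ?_, ?_, ?_⟩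
  -- Sigma-compactness makes a locally finite family of nonempty sets countable, as Baire's theorem
  -- will require.
  · exact countable_univ_iff.1 (fs.locallyFinite.countable_univ fun i => (fs i).nonempty_support)
  · rintro ⟨i, l⟩
    refine (fs i).contMDiff_smul (g := fun x => extChartAt (𝓡 m) (fs.c i) x l) ?_
    exact (EuclideanSpace.proj (𝕜 := ℝ) l).contDiff.contMDiff.comp_contMDiffOn
      contMDiffOn_extChartAt
  · intro x
    obtain ⟨t, ht, hfin⟩ := fs.locallyFinite x
    refine ⟨t, ht, (hfin.prod (finite_univ (α := Fin m))).subset ?_⟩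
    rintro ⟨i, l⟩ ⟨z, hz, hzt⟩
    exact ⟨⟨z, fun h => hz (by simp [h]), hzt⟩, mem_univ _⟩
  · intro x
    obtain ⟨i, hi⟩ := fs.eventuallyEq_one' x (mem_univ x)
    refine ⟨i, ?_⟩
    filter_upwards [hi] with z hz
    exact ⟨fs.mem_extChartAt_source_of_eq_one hz, fun l => by simp only [hz, Pi.one_apply, one_mul]⟩

theorem contMDiff_toLp_finsum {u : S → M → ℝ} (hu : ∀ s, ContMDiff (𝓡 m) 𝓘(ℝ) ∞ (u s))
    (hfin : LocallyFinite fun s => Function.support (u s)) {n : ℕ} (a : Fin n × S → ℝ) :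
    ContMDiff (𝓡 m) (𝓡 n) ∞ fun x =>
      (WithLp.toLp 2 fun k => ∑ᶠ s, a (k, s) * u s x : EuclideanSpace ℝ (Fin n)) := by
  refine (EuclideanSpace.equiv (Fin n) ℝ).symm.contDiff.contMDiff.comp
    (contMDiff_pi_space.2 fun k => contMDiff_finsum (fun s => contMDiff_const.mul (hu s)) ?_)
  exact hfin.subset fun s x hx h => hx (by simp [h])

theorem exists_nhds_isOpen_dense_span_eq_top [IsManifold (𝓡 m) ∞ M] {q : ℕ} (hq : m * (m + 1) ≤ 2 * q)
    [LocallyCompactSpace M] {u : S → M → ℝ} (hu : ∀ s, ContMDiff (𝓡 m) 𝓘(ℝ) ∞ (u s))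
    (hfin : LocallyFinite fun s => Function.support (u s)) {c x : M} {σ : Fin m → S}
    (hσ : ∀ᶠ z in 𝓝 x, z ∈ (extChartAt (𝓡 m) c).source ∧
        ∀ l, u (σ l) z = extChartAt (𝓡 m) c z l) :
    ∃ K ∈ 𝓝 x, ∃ G : Set (Fin q × Fin 2 × S → ℝ), IsOpen G ∧ Dense G ∧ ∀ A ∈ G, ∀ z ∈ K,
      Submodule.span ℝ (range fun i : Fin q => pullbackForm (𝓡 m) (𝓡 2)
        (fun x => WithLp.toLp 2 fun k => ∑ᶠ s, A (i, k, s) * u s x) dxdy z) =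
          (⊤ : Submodule ℝ (FormFibre (𝓡 m) 2 z)) := by
  classical
  obtain ⟨t, ht, htfin⟩ := hfin x
  obtain ⟨W, hWsub, hWo, hxW⟩ := mem_nhds_iff.1 (inter_mem ht hσ)
  set φ := extChartAt (𝓡 m) c with hφ
  obtain ⟨K, hKx, hKW, hK⟩ := local_compact_nhds (hWo.mem_nhds hxW)
  -- Only finitely many `u s` are nonzero on `W`; the coordinate indices are added so that their
  -- coefficients can be varied.
  let J : Finset S := htfin.toFinset ∪ Finset.univ.image σ
  have hJ : ∀ s, s ∉ J → ∀ z ∈ W, u s z = 0 := by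
    intro s hs z hz
    by_contra hne
    exact hs (Finset.mem_union_left _ (htfin.mem_toFinset.2 ⟨z, hne, (hWsub hz).1⟩))
  have hWs : W ⊆ φ.source := fun z hz => (hWsub hz).2.1
  have hV : IsOpen (φ.target ∩ φ.symm ⁻¹' W) :=
    (continuousOn_extChartAt_symm c).isOpen_inter_preimage (isOpen_extChartAt_target c) hWo
  have hh : ∀ s ∈ J, ContDiffOn ℝ ∞ (u s ∘ φ.symm) (φ.target ∩ φ.symm ⁻¹' W) := fun s _ =>
    (contMDiffOn_iff_contDiffOn.1 ((hu s).comp_contMDiffOn (contMDiffOn_extChartAt_symm c))).mono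
      inter_subset_left
  have hmap : ∀ z ∈ W, φ z ∈ φ.target ∩ φ.symm ⁻¹' W := fun z hz =>
    ⟨φ.map_source (hWs hz), by simpa [φ.left_inv (hWs hz)] using hz⟩
  have hσ' : ∀ l, ∀ y ∈ φ.target ∩ φ.symm ⁻¹' W, (u (σ l) ∘ φ.symm) y = y l := by
    rintro l y ⟨hyt, hyW⟩
    have := (hWsub hyW).2.2 l
    rwa [φ.right_inv hyt] at this
  have hKV : φ '' K ⊆ φ.target ∩ φ.symm ⁻¹' W := by
    rintro _ ⟨z, hz, rfl⟩
    exact hmap z (hKW hz)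
  have hdense : Dense {A : Fin q × Fin 2 × S → ℝ | ∀ y ∈ φ '' K,
      ¬ IsDegenerate (combinationJet J (fun s => u s ∘ φ.symm) A y)} := by
    refine (dense_setOf_forall_combinationJet hq hV hh (fun l => by simp [J]) hσ').mono ?_
    exact fun A hA y hy => hA y (hKV hy)
  refine ⟨K, hKx, _, isOpen_setOf_forall_combinationJet hV hh (hK.image_of_continuousOn
    ((continuousOn_extChartAt c).mono (hKW.trans hWs))) hKV,
    hdense, fun A hA z hz => ?_⟩
  have hzW := hKW hz
  obtain ⟨e, he⟩ := isInvertible_mfderiv_extChartAt (I := 𝓡 m) (hWs hzW)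
  refine span_range_eq_top_of_not_isDegenerate (F := TangentSpace (𝓡 m) z) e
    (hA _ (mem_image_of_mem φ hz)) _ fun i v k => ?_
  refine mfderiv_apply_eq_sum_partialDeriv (a := fun p => A (i, p)) (hWs hzW) ?_ (fun s hs =>
    ((hh s hs).contDiffAt (hV.mem_nhds (hmap z hzW))).differentiableAt (by simp)) rfl he.symm v k
  filter_upwards [hWo.mem_nhds hzW] with y hy k
  refine finsum_eq_sum_of_support_subset _ fun s hs => ?_
  by_contra hsJ
  exact hs (by simp [hJ s hsJ y hy])

end Manifold

theorem proposition3p1 (m q : ℕ) (hq : m * (m + 1) ≤ 2 * q)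
    (M : Type*) [TopologicalSpace M] [T2Space M] [SecondCountableTopology M]
    [ChartedSpace (EuclideanSpace ℝ (Fin m)) M] [IsManifold (𝓡 m) ∞ M] :
    ∃ f : Fin q → M → EuclideanSpace ℝ (Fin 2),
      (∀ i, ContMDiff (𝓡 m) (𝓡 2) ∞ (f i)) ∧
      ∀ x : M, Submodule.span ℝ
        (Set.range fun i : Fin q => pullbackForm (𝓡 m) (𝓡 2) (f i) dxdy x) =
          (⊤ : Submodule ℝ (FormFibre (𝓡 m) 2 x)) := by
  have : LocallyCompactSpace M := ChartedSpace.locallyCompactSpace (EuclideanSpace ℝ (Fin m)) M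
  obtain ⟨ι, _, c, u, hu, hfin, hcoord⟩ := exists_locallyFinite_coordinates (m := m) M
  choose i hi using hcoord
  choose K hK G hGo hGd hG using fun x =>
    exists_nhds_isOpen_dense_span_eq_top hq hu hfin (σ := fun l => (i x, l)) (hi x)
  obtain ⟨C, hC, hCK⟩ := TopologicalSpace.countable_cover_nhds hK
  -- Baire's theorem in the space of coefficients, a countable product of lines.
  obtain ⟨A, hA⟩ := (dense_biInter_of_isOpen (fun x _ => hGo x) hC fun x _ => hGd x).nonempty
  refine ⟨_, fun j => contMDiff_toLp_finsum hu hfin fun p : Fin 2 × (ι × Fin m) => A (j, p), fun z => ?_⟩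
  obtain ⟨x, hx, hz⟩ := mem_iUnion₂.1 (hCK ▸ mem_univ z)
  exact hG x A (mem_iInter₂.1 hA x hx) z hz
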